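/- Let $X$ be a real or complex Banach lattice. Here a real Banach lattice is a Banach space that is also a vector lattice, with $\|f\|\le\|g\|$ whenever $|f|\le|g|$. A complex Banach lattice is the complexification $X=Z_{\mathbb C}=Z\oplus iZ$ of a real Banach lattice $Z$, with modulus $|x+iy|=\sup_{\theta\in[0,2\pi]}(x\cos\theta+y\sin\theta)\in Z$ and norm $\|x+iy\|=\big\||x+iy|\big\|_Z$. Then there is a constant $K=K_X\in[1,\sqrt2]$, depending only on $X$, such that for all linearly independent $f,g\in X$ there exist $f',g'\in\operatorname{span}\{f,g\}$ with $$\min_{|\lambda|=1}\|f-\lambda g\|\le K\min_{|\lambda|=1}\|f'-\lambda g'\|,$$ $$\big(\|f'\|^2+\|g'\|^2\big)^{1/2}\le K\min_{|\lambda|=1}\|f'-\lambda g'\|,$$ $$\big\||f'|-|g'|\big\|\le\big\||f|-|g|\big\|.$$ Here linear independence and the span are taken over the scalar field of $X$, $\lambda$ ranges over the scalars of modulus $1$ in that field, and the minima are attained. -/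

import Mathlib

set_option linter.unusedSectionVars false

/-- The complexification `X_ℂ = X ⊕ iX` of a real vector space: `⟨x, y⟩` stands for `x + iy`. -/
@[ext]
structure LatticeComplexification (X : Type*) where
  /-- The real part. -/
  re : X
  /-- The imaginary part. -/
  im : X

namespace LatticeComplexification

section Algebra

variable {X : Type*} [AddCommGroup X] [Module ℝ X]

instance : Zero (LatticeComplexification X) := ⟨⟨0, 0⟩⟩
instance : Add (LatticeComplexification X) := ⟨fun z w => ⟨z.re + w.re, z.im + w.im⟩⟩
instance : Neg (LatticeComplexification X) := ⟨fun z => ⟨-z.re, -z.im⟩⟩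
instance : Sub (LatticeComplexification X) := ⟨fun z w => ⟨z.re - w.re, z.im - w.im⟩⟩

/-- `(a + ib)(x + iy) = (ax - by) + i(bx + ay)`. -/
instance : SMul ℂ (LatticeComplexification X) :=
  ⟨fun c z => ⟨c.re • z.re - c.im • z.im, c.im • z.re + c.re • z.im⟩⟩

@[simp] theorem zero_re : (0 : LatticeComplexification X).re = 0 := rfl
@[simp] theorem zero_im : (0 : LatticeComplexification X).im = 0 := rfl
@[simp] theorem add_re (z w : LatticeComplexification X) : (z + w).re = z.re + w.re := rfl
@[simp] theorem add_im (z w : LatticeComplexification X) : (z + w).im = z.im + w.im := rfl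
@[simp] theorem neg_re (z : LatticeComplexification X) : (-z).re = -z.re := rfl
@[simp] theorem neg_im (z : LatticeComplexification X) : (-z).im = -z.im := rfl
@[simp] theorem sub_re (z w : LatticeComplexification X) : (z - w).re = z.re - w.re := rfl
@[simp] theorem sub_im (z w : LatticeComplexification X) : (z - w).im = z.im - w.im := rfl
@[simp] theorem smul_re (c : ℂ) (z : LatticeComplexification X) :
    (c • z).re = c.re • z.re - c.im • z.im := rfl
@[simp] theorem smul_im (c : ℂ) (z : LatticeComplexification X) :
    (c • z).im = c.im • z.re + c.re • z.im := rfl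

instance : AddCommGroup (LatticeComplexification X) where
  add_assoc a b c := by ext <;> simp [add_assoc]
  zero_add a := by ext <;> simp
  add_zero a := by ext <;> simp
  add_comm a b := by ext <;> simp [add_comm]
  neg_add_cancel a := by ext <;> simp
  sub_eq_add_neg a b := by ext <;> simp [sub_eq_add_neg]
  nsmul := nsmulRec
  zsmul := zsmulRec

instance : Module ℂ (LatticeComplexification X) where
  one_smul z := by ext <;> simp
  mul_smul a b z := by
    ext
    · simp only [smul_re, smul_im, Complex.mul_re, Complex.mul_im]; module
    · simp only [smul_re, smul_im, Complex.mul_re, Complex.mul_im]; module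
  smul_zero a := by ext <;> simp
  smul_add a z w := by
    ext
    · simp only [smul_re, add_re, add_im]; module
    · simp only [smul_im, add_re, add_im]; module
  add_smul a b z := by
    ext
    · simp only [smul_re, add_re, Complex.add_re, Complex.add_im]; module
    · simp only [smul_im, add_im, Complex.add_re, Complex.add_im]; module
  zero_smul z := by ext <;> simp

/-- The real part `x cos θ + y sin θ` of `e^{-iθ}(x + iy)`. -/
noncomputable def rotation (z : LatticeComplexification X) (θ : ℝ) : X :=
  Real.cos θ • z.re + Real.sin θ • z.im

/-- The set `{x cos θ + y sin θ : θ ∈ [0, 2π]}`, whose supremum is the modulus of `x + iy`. -/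
noncomputable def rotationSet (z : LatticeComplexification X) : Set X :=
  z.rotation '' Set.Icc 0 (2 * Real.pi)

theorem rotation_mem (z : LatticeComplexification X) (θ : ℝ) :
    z.rotation θ ∈ z.rotationSet := by
  obtain ⟨n, hn, -⟩ := existsUnique_add_zsmul_mem_Ico Real.two_pi_pos θ 0
  refine ⟨θ + n • (2 * Real.pi), ⟨hn.1, by simpa using hn.2.le⟩, ?_⟩
  simp [rotation, Real.cos_add_int_mul_two_pi, Real.sin_add_int_mul_two_pi]

end Algebra

section Modulus

variable {X : Type*} [NormedAddCommGroup X] [NormedSpace ℝ X] [Lattice X] [HasSolidNorm X]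
  [IsOrderedAddMonoid X] [IsOrderedModule ℝ X]

theorem smul_le_of_abs_le {a d : ℝ} (h : |a| ≤ d) (x : X) : a • x ≤ d • |x| := by
  have h1 : a • x ≤ |a| • |x| := by
    rcases le_total 0 a with ha | ha
    · rw [abs_of_nonneg ha]
      exact smul_le_smul_of_nonneg_left (le_abs_self x) ha
    · rw [abs_of_nonpos ha, ← neg_smul_neg a x]
      exact smul_le_smul_of_nonneg_left (neg_le_abs x) (neg_nonneg.2 ha)
  exact h1.trans (smul_le_smul_of_nonneg_right h (abs_nonneg x))

theorem rotation_le (z : LatticeComplexification X) {θ φ d : ℝ} (h : |θ - φ| ≤ d) :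
    z.rotation θ ≤ z.rotation φ + d • (|z.re| + |z.im|) := by
  have h1 := smul_le_of_abs_le ((Real.abs_cos_sub_cos_le θ φ).trans h) z.re
  have h2 := smul_le_of_abs_le ((Real.abs_sin_sub_sin_le θ φ).trans h) z.im
  have h3 := add_le_add h1 h2
  have e : z.rotation θ = z.rotation φ +
      ((Real.cos θ - Real.cos φ) • z.re + (Real.sin θ - Real.sin φ) • z.im) := by
    simp only [rotation]; module
  rw [e, smul_add]
  gcongr

/-- The suprema defining the modulus exist in every real Banach lattice. -/
theorem exists_isLUB_rotationSet [CompleteSpace X] (z : LatticeComplexification X) :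
    ∃ m : X, IsLUB z.rotationSet m := by
  set u : X := |z.re| + |z.im| with hu
  have hu0 : 0 ≤ u := add_nonneg (abs_nonneg _) (abs_nonneg _)
  let d : ℕ → ℝ := fun n => 2 * Real.pi / ((n : ℝ) + 1)
  have hd0 : ∀ n, 0 ≤ d n := fun n => by positivity
  have hd : Filter.Tendsto d Filter.atTop (nhds 0) := by
    have := (tendsto_one_div_add_atTop_nhds_zero_nat (𝕜 := ℝ)).const_mul (2 * Real.pi)
    simpa [d, div_eq_mul_inv] using this
  -- suprema over finer and finer finite grids of angles
  let S : ℕ → X := fun n => (Finset.range (n + 1)).sup' ⟨0, by simp⟩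
    (fun k => z.rotation (k * d n))
  have hS : ∀ n θ, z.rotation θ ≤ S n + d n • u := by
    intro n θ
    obtain ⟨t, ht, hrot⟩ := z.rotation_mem θ
    rcases eq_or_lt_of_le ht.2 with h2 | h2
    · have h0 : z.rotation θ = z.rotation ((0 : ℕ) * d n) := by
        rw [← hrot, h2]; simp [rotation]
      rw [h0]
      exact (Finset.le_sup' (fun k : ℕ => z.rotation (k * d n)) (by simp)).trans
        (le_add_of_nonneg_right (smul_nonneg (hd0 n) hu0))
    · have hdpos : 0 < d n := by
        have := Real.pi_pos
        positivity
      have hk : ⌊t / d n⌋₊ ∈ Finset.range (n + 1) := by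
        rw [Finset.mem_range, Nat.floor_lt (div_nonneg ht.1 (hd0 n)), div_lt_iff₀ hdpos]
        have : ((n + 1 : ℕ) : ℝ) * d n = 2 * Real.pi := by
          simp only [d]; push_cast; field_simp
        rw [this]; exact h2
      have h3 : |t - ⌊t / d n⌋₊ * d n| ≤ d n := by
        have a1 := Nat.floor_le (div_nonneg ht.1 (hd0 n))
        have a2 := Nat.lt_floor_add_one (t / d n)
        rw [le_div_iff₀ hdpos] at a1
        rw [div_lt_iff₀ hdpos] at a2
        rw [abs_le]
        constructor <;> nlinarith
      rw [← hrot]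
      refine (z.rotation_le h3).trans ?_
      gcongr
      exact Finset.le_sup' (fun k : ℕ => z.rotation (k * d n)) hk
  have hSb : ∀ n b, (∀ θ, z.rotation θ ≤ b) → S n ≤ b := fun n b hb =>
    Finset.sup'_le _ _ fun k _ => hb _
  have hSS : ∀ n m, ‖S n - S m‖ ≤ (d n + d m) * ‖u‖ := by
    intro n m
    have key : |S n - S m| ≤ (d n + d m) • u := by
      rw [abs_le', add_smul]
      constructor
      · refine (sub_le_iff_le_add'.2 (hSb n _ (hS m))).trans ?_
        exact le_add_of_nonneg_left (smul_nonneg (hd0 n) hu0)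
      · rw [neg_sub]
        refine (sub_le_iff_le_add'.2 (hSb m _ (hS n))).trans ?_
        exact le_add_of_nonneg_right (smul_nonneg (hd0 m) hu0)
    have h0 : 0 ≤ (d n + d m) • u := smul_nonneg (add_nonneg (hd0 n) (hd0 m)) hu0
    have := norm_le_norm_of_abs_le_abs (key.trans (le_abs_self _))
    rwa [norm_smul, Real.norm_of_nonneg (add_nonneg (hd0 n) (hd0 m))] at this
  have hC : CauchySeq S := by
    refine Metric.cauchySeq_iff'.2 fun ε hε => ?_
    have hlim : Filter.Tendsto (fun n => 2 * d n * ‖u‖) Filter.atTop (nhds 0) := by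
      simpa using (hd.const_mul 2).mul_const ‖u‖
    obtain ⟨N, hN⟩ := (hlim.eventually (gt_mem_nhds hε)).exists
    refine ⟨N, fun n hn => ?_⟩
    rw [dist_eq_norm]
    refine lt_of_le_of_lt ((hSS n N).trans ?_) hN
    have hle : d n ≤ d N := by
      have h4 : (N : ℝ) ≤ n := by exact_mod_cast hn
      have := Real.pi_pos
      simp only [d]
      gcongr
    have := norm_nonneg u
    nlinarith
  obtain ⟨m, hm⟩ := cauchySeq_tendsto_of_complete hC
  refine ⟨m, ?_, ?_⟩
  · rintro _ ⟨θ, -, rfl⟩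
    have hlim : Filter.Tendsto (fun n => S n + d n • u) Filter.atTop (nhds m) := by
      simpa using hm.add (hd.smul_const u)
    exact ge_of_tendsto' hlim fun n => hS n θ
  · intro b hb
    exact le_of_tendsto' hm fun n => hSb n b fun θ => hb (z.rotation_mem θ)

variable [CompleteSpace X]

/-- The modulus `|x + iy| = sup {x cos θ + y sin θ : θ ∈ [0, 2π]}`, an element of `X`. -/
noncomputable def modulus (z : LatticeComplexification X) : X :=
  Classical.choose z.exists_isLUB_rotationSet

theorem isLUB_modulus (z : LatticeComplexification X) : IsLUB z.rotationSet z.modulus :=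
  Classical.choose_spec z.exists_isLUB_rotationSet

theorem rotation_le_modulus (z : LatticeComplexification X) (θ : ℝ) :
    z.rotation θ ≤ z.modulus :=
  z.isLUB_modulus.1 (z.rotation_mem θ)

theorem modulus_le {z : LatticeComplexification X} {b : X} (h : ∀ θ, z.rotation θ ≤ b) :
    z.modulus ≤ b :=
  z.isLUB_modulus.2 (by rintro _ ⟨θ, -, rfl⟩; exact h θ)

theorem abs_re_le_modulus (z : LatticeComplexification X) : |z.re| ≤ z.modulus := by
  refine abs_le'.2 ⟨?_, ?_⟩
  · simpa [rotation] using z.rotation_le_modulus 0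
  · simpa [rotation] using z.rotation_le_modulus Real.pi

theorem abs_im_le_modulus (z : LatticeComplexification X) : |z.im| ≤ z.modulus := by
  refine abs_le'.2 ⟨?_, ?_⟩
  · simpa [rotation] using z.rotation_le_modulus (Real.pi / 2)
  · simpa [rotation] using z.rotation_le_modulus (-(Real.pi / 2))

theorem modulus_nonneg (z : LatticeComplexification X) : 0 ≤ z.modulus :=
  (abs_nonneg _).trans z.abs_re_le_modulus

theorem modulus_add_le (z w : LatticeComplexification X) :
    (z + w).modulus ≤ z.modulus + w.modulus := by
  refine modulus_le fun θ => ?_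
  have e : (z + w).rotation θ = z.rotation θ + w.rotation θ := by
    simp only [rotation, add_re, add_im]; module
  rw [e]
  exact add_le_add (z.rotation_le_modulus θ) (w.rotation_le_modulus θ)

theorem modulus_smul_le (c : ℂ) (z : LatticeComplexification X) :
    (c • z).modulus ≤ ‖c‖ • z.modulus := by
  refine modulus_le fun θ => ?_
  have e : (c • z).rotation θ = ‖c‖ • z.rotation (θ - c.arg) := by
    simp only [rotation, smul_re, smul_im, Real.cos_sub, Real.sin_sub]
    rw [← Complex.norm_mul_cos_arg c, ← Complex.norm_mul_sin_arg c]
    module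
  rw [e]
  exact smul_le_smul_of_nonneg_left (z.rotation_le_modulus _) (norm_nonneg c)

/-- The norm `‖x + iy‖ = ‖ |x + iy| ‖`. -/
noncomputable instance : Norm (LatticeComplexification X) := ⟨fun z => ‖z.modulus‖⟩

theorem norm_def (z : LatticeComplexification X) : ‖z‖ = ‖z.modulus‖ := rfl

theorem norm_le_of_modulus_le {z : LatticeComplexification X} {b : X} (h : z.modulus ≤ b) :
    ‖z‖ ≤ ‖b‖ :=
  norm_le_norm_of_abs_le_abs (by
    rw [abs_of_nonneg z.modulus_nonneg]
    exact h.trans (le_abs_self b))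

theorem norm_smul_le_aux (c : ℂ) (z : LatticeComplexification X) : ‖c • z‖ ≤ ‖c‖ * ‖z‖ := by
  have h := norm_le_of_modulus_le (modulus_smul_le c z)
  rwa [norm_smul (‖c‖) z.modulus, norm_norm] at h

theorem normedSpaceCore : NormedSpace.Core ℂ (LatticeComplexification X) where
  norm_nonneg z := norm_nonneg z.modulus
  norm_smul c z := by
    refine le_antisymm (norm_smul_le_aux c z) ?_
    rcases eq_or_ne c 0 with rfl | hc
    · rw [norm_zero, zero_mul]
      exact norm_nonneg (modulus ((0 : ℂ) • z))
    · have h := norm_smul_le_aux c⁻¹ (c • z)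
      rw [inv_smul_smul₀ hc, norm_inv] at h
      exact (le_inv_mul_iff₀ (norm_pos_iff.2 hc)).1 h
  norm_triangle z w :=
    (norm_le_of_modulus_le (modulus_add_le z w)).trans (norm_add_le z.modulus w.modulus)
  norm_eq_zero_iff z := by
    constructor
    · intro h
      have h0 : z.modulus = 0 := norm_eq_zero.1 h
      have h1 := z.abs_re_le_modulus
      have h2 := z.abs_im_le_modulus
      rw [h0] at h1 h2
      have e1 := abs_le'.1 h1
      have e2 := abs_le'.1 h2
      ext
      · exact le_antisymm e1.1 (neg_nonpos.1 e1.2)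
      · exact le_antisymm e2.1 (neg_nonpos.1 e2.2)
    · rintro rfl
      refine norm_eq_zero.2 (le_antisymm (modulus_le fun θ => ?_)
        (modulus_nonneg (0 : LatticeComplexification X)))
      simp [rotation]

noncomputable instance : NormedAddCommGroup (LatticeComplexification X) :=
  NormedAddCommGroup.ofCore normedSpaceCore

noncomputable instance : NormedSpace ℂ (LatticeComplexification X) :=
  NormedSpace.ofCore normedSpaceCore
end Modulus

end LatticeComplexification

/-- The values `‖f - λg‖` for scalars `λ` with `|λ| = 1`. -/
def phaseDistances (𝕜 : Type*) {E : Type*} [NormedField 𝕜] [NormedAddCommGroup E]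
    [NormedSpace 𝕜 E] (f g : E) : Set ℝ :=
  {r : ℝ | ∃ c : 𝕜, ‖c‖ = 1 ∧ r = ‖f - c • g‖}

/-! In both cases `f', g'` come from `f, g` by shrinking the sum or the difference, which cannot
increase the distance between the moduli because `||f| - |g||` is the infimum of `|f - λg|` over
unit scalars `λ`. The constant `√2` serves throughout.

Real case: the infimum is `|f - g| ⊓ |f + g|`. Shrink `f - g` and `f + g` separately to the common
norm `d = min ‖f ± g‖`; then `d' = d`, and `f'`, `g'` have norm at most `d`.

Complex case: the span of `f, g` is `√2`-isomorphic to a Hilbert space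
(`exists_euclidean_sqrt_two_equiv`). There a phase `c` makes the inner product of `F` and `cG`
nonnegative, and shrinking `F + cG` by some `t ≤ 1` gives an orthogonal pair, for which `‖F' - λG'‖²
= ‖F'‖² + ‖G'‖²` for every unit `λ` (`exists_unit_smul_rescale_orthogonal`). The isomorphism costs
`√2` in each norm bound. The moduli are compared directly in the lattice
(`norm_modulus_sub_modulus_le`), so that inequality loses no constant. -/

theorem exists_isLeast_phaseDistances (𝕜 : Type*) {E : Type*} [RCLike 𝕜] [NormedAddCommGroup E]
    [NormedSpace 𝕜 E] (f g : E) : ∃ d, IsLeast (phaseDistances 𝕜 f g) d := by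
  have hc : IsCompact ((fun c : 𝕜 => ‖f - c • g‖) '' Metric.sphere 0 1) :=
    (isCompact_sphere _ _).image (by fun_prop)
  obtain ⟨d, hd⟩ := hc.exists_isLeast ⟨_, 1, by simp, rfl⟩
  have e : phaseDistances 𝕜 f g = (fun c : 𝕜 => ‖f - c • g‖) '' Metric.sphere 0 1 := by
    ext r
    simp [phaseDistances, eq_comm]
  exact ⟨d, e ▸ hd⟩

/-! ### The real case. -/

section RealLattice

variable {X : Type*} [AddCommGroup X] [Lattice X] [IsOrderedAddMonoid X]

/-- By distributivity `|f - g| ⊓ |f + g|` is the join of four meets, each bounded through `(a - b) ⊓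
(a + b) = a - |b|` by `|f| - |g|` or `|g| - |f|`. -/
theorem le_abs_abs_sub_abs {f g h : X} (h₁ : h ≤ |f - g|) (h₂ : h ≤ |f + g|) :
    h ≤ |(|f| - |g|)| := by
  let := AddCommGroup.toDistribLattice X
  refine (le_inf h₁ h₂).trans ?_
  have k1 : |f| - |g| ≤ |(|f| - |g|)| := le_abs_self _
  have k2 : |g| - |f| ≤ |(|f| - |g|)| := by simpa using neg_le_abs (|f| - |g|)
  have e (a b : X) : (a - b) ⊓ (a + b) ≤ a - |b| := by
    rw [sub_eq_add_neg, ← add_inf, sub_eq_add_neg, abs, neg_sup, neg_neg, inf_comm]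
  rw [abs, abs, inf_sup_left, inf_sup_right, inf_sup_right]
  refine sup_le (sup_le ?_ ?_) (sup_le ?_ ?_)
  · exact (e f g).trans ((sub_le_sub_right (le_abs_self f) _).trans k1)
  · refine le_trans ?_ ((sub_le_sub_right (le_abs_self g) _).trans k2)
    refine le_trans ?_ (e g f)
    simp [add_comm]
  · refine le_trans ?_ ((sub_le_sub_right (neg_le_abs g) _).trans k2)
    refine le_trans (le_of_eq ?_) (e (-g) f)
    rw [inf_comm]
    congr 1 <;> abel
  · refine le_trans ?_ ((sub_le_sub_right (neg_le_abs f) _).trans k1)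
    refine le_trans (le_of_eq ?_) (e (-f) g)
    rw [inf_comm]
    congr 1 <;> abel

end RealLattice

theorem exists_nearly_orthogonal_pair_real {X : Type*} [NormedAddCommGroup X] [NormedSpace ℝ X]
    [Lattice X] [IsOrderedAddMonoid X] [IsOrderedModule ℝ X] [HasSolidNorm X]
    (f g : X) (hfg : LinearIndependent ℝ ![f, g]) :
    ∃ f' ∈ Submodule.span ℝ {f, g}, ∃ g' ∈ Submodule.span ℝ {f, g}, ∃ d d' : ℝ,
      IsLeast (phaseDistances ℝ f g) d ∧ IsLeast (phaseDistances ℝ f' g') d' ∧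
      d ≤ Real.sqrt 2 * d' ∧ Real.sqrt (‖f'‖ ^ 2 + ‖g'‖ ^ 2) ≤ Real.sqrt 2 * d' ∧
      ‖|f'| - |g'|‖ ≤ ‖|f| - |g|‖ := by
  rw [LinearIndependent.pair_iff] at hfg
  have hu : 0 < ‖f - g‖ := norm_pos_iff.2 fun h => by
    have := hfg 1 (-1) (by rw [← h]; module)
    simp at this
  have hv : 0 < ‖f + g‖ := norm_pos_iff.2 fun h => by
    have := hfg 1 1 (by rw [← h]; module)
    simp at this
  obtain ⟨d, hd⟩ := exists_isLeast_phaseDistances ℝ f g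
  have hdu : d ≤ ‖f - g‖ := hd.2 ⟨1, by simp, by simp⟩
  have hdv : d ≤ ‖f + g‖ := hd.2 ⟨-1, by simp, by simp⟩
  have hd0 : 0 ≤ d := by
    obtain ⟨c, -, h⟩ := hd.1
    rw [h]
    exact norm_nonneg _
  -- One of `s`, `t` is `1`; the other shrinks the longer of `f - g`, `f + g` to length `d`.
  set s := d / ‖f - g‖ with hs
  set t := d / ‖f + g‖ with ht
  have hs0 : 0 ≤ s := by positivity
  have ht0 : 0 ≤ t := by positivity
  have hs1 : s ≤ 1 := div_le_one_of_le₀ hdu hu.le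
  have ht1 : t ≤ 1 := div_le_one_of_le₀ hdv hv.le
  have nu : ‖s • (f - g)‖ = d := by
    rw [norm_smul, Real.norm_of_nonneg hs0, hs, div_mul_cancel₀ _ hu.ne']
  have nv : ‖t • (f + g)‖ = d := by
    rw [norm_smul, Real.norm_of_nonneg ht0, ht, div_mul_cancel₀ _ hv.ne']
  have hf : f ∈ Submodule.span ℝ {f, g} := Submodule.subset_span (by simp)
  have hg : g ∈ Submodule.span ℝ {f, g} := Submodule.subset_span (by simp)
  have hus := Submodule.smul_mem _ s (sub_mem hf hg)
  have hvs := Submodule.smul_mem _ t (add_mem hf hg)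
  set f' : X := (1 / 2 : ℝ) • (t • (f + g) + s • (f - g)) with hf'
  set g' : X := (1 / 2 : ℝ) • (t • (f + g) - s • (f - g)) with hg'
  have e1 : f' - g' = s • (f - g) := by rw [hf', hg']; module
  have e2 : f' + g' = t • (f + g) := by rw [hf', hg']; module
  have hnf : ‖f'‖ ≤ d := by
    rw [hf', norm_smul]
    have := norm_add_le (t • (f + g)) (s • (f - g))
    rw [Real.norm_of_nonneg (by norm_num)]
    linarith
  have hng : ‖g'‖ ≤ d := by
    rw [hg', norm_smul]
    have := norm_sub_le (t • (f + g)) (s • (f - g))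
    rw [Real.norm_of_nonneg (by norm_num)]
    linarith
  refine ⟨f', Submodule.smul_mem _ _ (add_mem hvs hus), g',
    Submodule.smul_mem _ _ (sub_mem hvs hus), d, d, hd, ⟨⟨1, by simp, ?_⟩, ?_⟩, ?_, ?_, ?_⟩
  · rw [one_smul, e1, nu]
  · rintro _ ⟨c, hc, rfl⟩
    rcases eq_or_eq_neg_of_abs_eq hc with rfl | rfl
    · rw [one_smul, e1, nu]
    · rw [neg_smul, one_smul, sub_neg_eq_add, e2, nv]
  · exact le_mul_of_one_le_left hd0 (Real.one_le_sqrt.2 (by norm_num))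
  · rw [← Real.sqrt_sq hd0, ← Real.sqrt_mul (by norm_num)]
    refine Real.sqrt_le_sqrt ?_
    have := pow_le_pow_left₀ (norm_nonneg _) hnf 2
    have := pow_le_pow_left₀ (norm_nonneg _) hng 2
    linarith
  · have shrink (r : ℝ) (hr0 : 0 ≤ r) (hr1 : r ≤ 1) (x : X) : |r • x| ≤ |x| := by
      have hr : |r| ≤ 1 := abs_le.2 ⟨by linarith, hr1⟩
      have h1 := LatticeComplexification.smul_le_of_abs_le hr x
      have h2 := LatticeComplexification.smul_le_of_abs_le ((abs_neg r).trans_le hr) x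
      rw [one_smul] at h1 h2
      exact abs_le'.2 ⟨h1, by rwa [← neg_smul]⟩
    refine norm_le_norm_of_abs_le_abs (le_abs_abs_sub_abs ?_ ?_)
    · exact (abs_abs_sub_abs_le f' g').trans (e1 ▸ shrink s hs0 hs1 _)
    · refine le_trans ?_ (e2 ▸ shrink t ht0 ht1 _)
      simpa using abs_abs_sub_abs_le f' (-g')

/-! ### Two-dimensional complex normed spaces: the extremal ellipsoid. -/

/-- The matrix with rows `(α, β)` and `(-β̄, ᾱ)` is `√(|α|² + |β|²)` times a unitary one. -/
theorem norm_sq_add_norm_sq_rotate (α β s t : ℂ) :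
    ‖α * s + β * t‖ ^ 2 + ‖-(starRingEnd ℂ β) * s + starRingEnd ℂ α * t‖ ^ 2 =
      (‖α‖ ^ 2 + ‖β‖ ^ 2) * (‖s‖ ^ 2 + ‖t‖ ^ 2) := by
  simp only [Complex.sq_norm, Complex.normSq_apply, Complex.add_re, Complex.add_im,
    Complex.mul_re, Complex.mul_im, Complex.neg_re, Complex.neg_im, Complex.conj_re,
    Complex.conj_im]
  ring

/-- Every two-dimensional complex normed space is `√2`-isomorphic to a Hilbert space: the Hilbert
norm is the one whose ball is the ellipsoid of least volume containing the unit ball. -/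
theorem exists_euclidean_sqrt_two_equiv {E : Type*} [NormedAddCommGroup E] [NormedSpace ℂ E]
    (f g : E) (hfg : LinearIndependent ℂ ![f, g]) :
    ∃ F G : EuclideanSpace ℂ (Fin 2), ∀ a b : ℂ,
      ‖a • F + b • G‖ ≤ ‖a • f + b • g‖ ∧
        ‖a • f + b • g‖ ≤ Real.sqrt 2 * ‖a • F + b • G‖ := by
  -- `(p₁, p₂), (q₁, q₂)` are the images of `f` and `g`
  let N (p : (ℂ × ℂ) × (ℂ × ℂ)) (a b : ℂ) : ℝ :=
    ‖a * p.1.1 + b * p.2.1‖ ^ 2 + ‖a * p.1.2 + b * p.2.2‖ ^ 2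
  let S : Set ((ℂ × ℂ) × (ℂ × ℂ)) := {p | ∀ a b : ℂ, N p a b ≤ ‖a • f + b • g‖ ^ 2}
  let D (p : (ℂ × ℂ) × (ℂ × ℂ)) : ℂ := p.1.1 * p.2.2 - p.1.2 * p.2.1
  have hclosed : IsClosed S := by
    simp only [S, Set.ofPred_forall]
    refine isClosed_iInter fun a => isClosed_iInter fun b => isClosed_le ?_ continuous_const
    simp only [N]
    fun_prop
  have hbdd : S ⊆ Metric.closedBall 0 (max ‖f‖ ‖g‖) := by
    intro p hp
    have hf := hp 1 0
    have hg := hp 0 1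
    simp only [N, one_mul, zero_mul, add_zero, one_smul, zero_smul, zero_add] at hf hg
    rw [mem_closedBall_zero_iff, Prod.norm_def, Prod.norm_def, Prod.norm_def]
    refine max_le_max (max_le ?_ ?_) (max_le ?_ ?_) <;>
      refine le_of_sq_le_sq ?_ (norm_nonneg _) <;> nlinarith [sq_nonneg ‖p.1.1‖, sq_nonneg ‖p.1.2‖,
        sq_nonneg ‖p.2.1‖, sq_nonneg ‖p.2.2‖]
  have hcomp : IsCompact S := (isCompact_closedBall _ _).of_isClosed_subset hclosed hbdd
  obtain ⟨p₀, hp₀, hDp₀⟩ : ∃ p ∈ S, D p ≠ 0 := by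
    let T : ℂ × ℂ →ₗ[ℂ] E :=
      (LinearMap.toSpanSingleton ℂ E f).coprod (LinearMap.toSpanSingleton ℂ E g)
    have hT : LinearMap.ker T = ⊥ := by
      rw [LinearMap.ker_eq_bot']
      rintro ⟨a, b⟩ h
      have := LinearIndependent.pair_iff.1 hfg a b (by simpa [T] using h)
      simp [this]
    obtain ⟨K, hK, hTK⟩ := T.exists_antilipschitzWith hT
    have hKpos : (0 : ℝ) < K := hK
    have hlow (a b : ℂ) : ‖a‖ ≤ K * ‖a • f + b • g‖ ∧ ‖b‖ ≤ K * ‖a • f + b • g‖ := by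
      have := hTK.le_mul_dist (a, b) 0
      rw [map_zero, dist_zero_right, dist_zero_right, Prod.norm_def] at this
      simpa [T] using this
    -- A small multiple of the coordinate map: each coordinate is at most half the norm, so the
    -- squares sum to at most half its square.
    refine ⟨((((2 * K : ℝ) : ℂ)⁻¹, 0), (0, ((2 * K : ℝ) : ℂ)⁻¹)), fun a b => ?_, ?_⟩
    · obtain ⟨ha, hb⟩ := hlow a b
      simp only [N, mul_zero, add_zero, zero_add, norm_mul, norm_inv, Complex.norm_real,
        Real.norm_of_nonneg (by positivity : (0 : ℝ) ≤ 2 * K)]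
      have h2 : ∀ c : ℂ, ‖c‖ ≤ K * ‖a • f + b • g‖ → ‖c‖ * (2 * K : ℝ)⁻¹ ≤ ‖a • f + b • g‖ / 2 := by
        intro c hc
        rw [← div_eq_mul_inv, div_le_iff₀ (by positivity)]
        linarith
      have ha' := pow_le_pow_left₀ (by positivity) (h2 a ha) 2
      have hb' := pow_le_pow_left₀ (by positivity) (h2 b hb) 2
      nlinarith [sq_nonneg ‖a • f + b • g‖]
    · have : (K : ℂ) ≠ 0 := by exact_mod_cast hKpos.ne'
      simp [D, this]
  obtain ⟨p, hp, hmax⟩ := hcomp.exists_isMaxOn ⟨p₀, hp₀⟩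
    (show Continuous fun p => ‖D p‖ by fun_prop).continuousOn
  have hD : D p ≠ 0 := norm_pos_iff.1 ((norm_pos_iff.2 hDp₀).trans_le (hmax hp₀))
  obtain ⟨⟨p₁, p₂⟩, ⟨q₁, q₂⟩⟩ := p
  simp only [D] at hD
  have hNeq (a b : ℂ) : ‖a • !₂[p₁, p₂] + b • !₂[q₁, q₂]‖ ^ 2 = N ((p₁, p₂), (q₁, q₂)) a b := by
    rw [EuclideanSpace.norm_sq_eq, Fin.sum_univ_two]
    simp [N]
  refine ⟨!₂[p₁, p₂], !₂[q₁, q₂], fun a b => ⟨le_of_sq_le_sq ?_ (norm_nonneg _), ?_⟩⟩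
  · rw [hNeq]
    exact hp a b
  -- Write a norming functional of the given vector in Euclidean coordinates as `(α, β)`. Once its
  -- squared length is at most `2`, Cauchy–Schwarz gives the upper bound.
  obtain ⟨η, hη1, hη⟩ := exists_dual_vector'' ℂ (a • f + b • g)
  obtain ⟨α, β, hαf, hβg⟩ : ∃ α β : ℂ, α * p₁ + β * p₂ = η f ∧ α * q₁ + β * q₂ = η g := by
    refine ⟨(η f * q₂ - η g * p₂) / (p₁ * q₂ - p₂ * q₁),
      (η g * p₁ - η f * q₁) / (p₁ * q₂ - p₂ * q₁), ?_, ?_⟩ <;>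
      rw [div_mul_eq_mul_div, div_mul_eq_mul_div, ← add_div, div_eq_iff hD] <;> ring
  have hηval (a b : ℂ) : α * (a * p₁ + b * q₁) + β * (a * p₂ + b * q₂) = η (a • f + b • g) := by
    rw [map_add, map_smul, map_smul, ← hαf, ← hβg, smul_eq_mul, smul_eq_mul]
    ring
  have hρ : ‖α‖ ^ 2 + ‖β‖ ^ 2 ≤ 2 := by
    by_contra! hρ
    set R := ‖α‖ ^ 2 + ‖β‖ ^ 2 with hR
    -- If `R > 2`, the form `(1 - c)N + c|η|²` is still dominated by the squared norm. Relative to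
    -- `N` it has eigenvalues `1 - c + cR` (along `η`) and `1 - c`. The `c` chosen maximizes their
    -- product, which then exceeds `1` and contradicts the maximality of the determinant.
    obtain ⟨c, hc0, hc1, hc⟩ : ∃ c : ℝ, 0 < c ∧ c < 1 ∧ 1 < (1 - c) * (1 - c + c * R) := by
      have h1 : 0 < R - 1 := by linarith
      refine ⟨(R - 2) / (2 * (R - 1)), div_pos (by linarith) (by linarith), ?_, ?_⟩
      · rw [div_lt_one (by linarith)]
        linarith
      · have e : (1 - (R - 2) / (2 * (R - 1))) *
            (1 - (R - 2) / (2 * (R - 1)) + (R - 2) / (2 * (R - 1)) * R) =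
            1 + (R - 2) ^ 2 / (4 * (R - 1)) := by
          field_simp
          ring
        rw [e]
        have : 0 < (R - 2) ^ 2 / (4 * (R - 1)) :=
          div_pos (pow_pos (by linarith) 2) (by linarith)
        linarith
    have hRpos : 0 < R := by linarith
    have hA : 0 ≤ (1 - c + c * R) / R := by
      have := mul_pos hc0 hRpos
      exact div_nonneg (by linarith) hRpos.le
    have hB : 0 ≤ (1 - c) / R := div_nonneg (by linarith) hRpos.le
    set A : ℝ := Real.sqrt ((1 - c + c * R) / R)
    set B : ℝ := Real.sqrt ((1 - c) / R)
    have hA2 : A ^ 2 = (1 - c + c * R) / R := Real.sq_sqrt hA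
    have hB2 : B ^ 2 = (1 - c) / R := Real.sq_sqrt hB
    -- Coordinates for the new form: rotate so that `η` is the first axis, then rescale the axes.
    -- The divisor `R` in `A²` and `B²` undoes the scaling of the rotation.
    let p' : (ℂ × ℂ) × (ℂ × ℂ) :=
      ((A * (α * p₁ + β * p₂), B * (-(starRingEnd ℂ β) * p₁ + starRingEnd ℂ α * p₂)),
        (A * (α * q₁ + β * q₂), B * (-(starRingEnd ℂ β) * q₁ + starRingEnd ℂ α * q₂)))
    have hp' : p' ∈ S := by
      intro a b
      have e : N p' a b = A ^ 2 * ‖α * (a * p₁ + b * q₁) + β * (a * p₂ + b * q₂)‖ ^ 2 +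
          B ^ 2 * ‖-(starRingEnd ℂ β) * (a * p₁ + b * q₁) +
            starRingEnd ℂ α * (a * p₂ + b * q₂)‖ ^ 2 := by
        simp only [N, p']
        rw [← sq_abs A, ← sq_abs B, ← Real.norm_eq_abs, ← Real.norm_eq_abs, ← Complex.norm_real,
          ← Complex.norm_real, ← mul_pow, ← mul_pow, ← norm_mul, ← norm_mul]
        congr 3 <;> ring_nf
      have h1 := norm_sq_add_norm_sq_rotate α β (a * p₁ + b * q₁) (a * p₂ + b * q₂)
      have h2 : ‖α * (a * p₁ + b * q₁) + β * (a * p₂ + b * q₂)‖ ^ 2 ≤ ‖a • f + b • g‖ ^ 2 := by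
        rw [hηval]
        refine pow_le_pow_left₀ (norm_nonneg _) ((η.le_opNorm _).trans ?_) 2
        exact mul_le_of_le_one_left (norm_nonneg _) hη1
      have h3 := hp a b
      simp only [N] at h3
      rw [e, eq_sub_of_add_eq' h1, hA2, hB2, ← hR]
      generalize ‖α * (a * p₁ + b * q₁) + β * (a * p₂ + b * q₂)‖ ^ 2 = x at *
      generalize ‖a * p₁ + b * q₁‖ ^ 2 + ‖a * p₂ + b * q₂‖ ^ 2 = y at *
      have e2 : (1 - c + c * R) / R * x + (1 - c) / R * (R * y - x) = (1 - c) * y + c * x := by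
        field_simp
        ring
      rw [e2]
      nlinarith
    have hDp' : D p' = (A * B * R : ℝ) * (p₁ * q₂ - p₂ * q₁) := by
      have hRc : (R : ℂ) = α * starRingEnd ℂ α + β * starRingEnd ℂ β := by
        rw [hR, Complex.mul_conj, Complex.mul_conj, Complex.normSq_eq_norm_sq,
          Complex.normSq_eq_norm_sq]
        push_cast
        rfl
      push_cast
      rw [hRc]
      simp only [D, p']
      ring
    have h := hmax hp'
    simp only [Set.mem_ofPred_eq, D] at h
    change ‖D p'‖ ≤ _ at h
    rw [hDp', norm_mul, Complex.norm_real] at h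
    have h4 := (mul_le_iff_le_one_left (norm_pos_iff.2 hD)).1 h
    have h5 : (A * B * R) ^ 2 = (1 - c) * (1 - c + c * R) := by
      rw [mul_pow, mul_pow, hA2, hB2]
      field_simp
    rw [Real.norm_eq_abs] at h4
    have := (sq_le_one_iff_abs_le_one _).2 h4
    linarith
  refine le_of_sq_le_sq ?_ (by positivity)
  rw [mul_pow, Real.sq_sqrt (by norm_num), hNeq]
  have h1 := norm_sq_add_norm_sq_rotate α β (a * p₁ + b * q₁) (a * p₂ + b * q₂)
  rw [hηval, hη] at h1
  simp only [RCLike.norm_ofReal, abs_norm] at h1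
  simp only [N]
  nlinarith [sq_nonneg ‖a * p₁ + b * q₁‖, sq_nonneg ‖a * p₂ + b * q₂‖,
    sq_nonneg ‖-(starRingEnd ℂ β) * (a * p₁ + b * q₁) + starRingEnd ℂ α * (a * p₂ + b * q₂)‖]

/-! ### The complex modulus and the distance between moduli. -/

namespace LatticeComplexification

variable {X : Type*} [NormedAddCommGroup X] [NormedSpace ℝ X] [Lattice X] [HasSolidNorm X]
  [IsOrderedAddMonoid X] [IsOrderedModule ℝ X] [CompleteSpace X]

theorem modulus_smul (c : ℂ) (z : LatticeComplexification X) :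
    (c • z).modulus = ‖c‖ • z.modulus := by
  refine le_antisymm (modulus_smul_le c z) ?_
  rcases eq_or_ne c 0 with rfl | hc
  · simpa using modulus_nonneg ((0 : ℂ) • z)
  · have h := smul_le_smul_of_nonneg_left (modulus_smul_le c⁻¹ (c • z)) (norm_nonneg c)
    rwa [inv_smul_smul₀ hc, norm_inv, smul_inv_smul₀ (norm_ne_zero_iff.2 hc)] at h

theorem abs_modulus_sub_modulus_le (z w : LatticeComplexification X) :
    |z.modulus - w.modulus| ≤ (z - w).modulus := by
  refine abs_le'.2 ⟨?_, ?_⟩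
  · simpa [sub_le_iff_le_add] using modulus_add_le (z - w) w
  · have h := modulus_smul (-1) (z - w)
    rw [norm_neg, norm_one, one_smul] at h
    rw [neg_sub, sub_le_iff_le_add, ← h]
    simpa using modulus_add_le ((-1 : ℂ) • (z - w)) z

theorem modulus_mk_zero_le (x : X) : (⟨x, 0⟩ : LatticeComplexification X).modulus ≤ |x| :=
  modulus_le fun θ => by
    simpa [rotation] using smul_le_of_abs_le (Real.abs_cos_le_one θ) x

/-- In polar coordinates `a + ib` turns the left side into a nonnegative multiple of a single
rotation of `z`. -/
theorem smul_re_add_smul_im_le (z : LatticeComplexification X) {a b r : ℝ} (hr : 0 ≤ r)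
    (h : a ^ 2 + b ^ 2 ≤ r ^ 2) : a • z.re + b • z.im ≤ r • z.modulus := by
  set w : ℂ := ⟨a, b⟩
  have hw : ‖w‖ ≤ r := by
    refine le_of_sq_le_sq ?_ hr
    rw [Complex.sq_norm, Complex.normSq_apply]
    simpa [w, sq] using h
  have e : a • z.re + b • z.im = ‖w‖ • z.rotation w.arg := by
    rw [rotation, smul_add, smul_smul, smul_smul, Complex.norm_mul_cos_arg,
      Complex.norm_mul_sin_arg]
  rw [e]
  exact (smul_le_smul_of_nonneg_left (z.rotation_le_modulus _) (norm_nonneg w)).trans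
    (smul_le_smul_of_nonneg_right hw z.modulus_nonneg)

/-- `|z - e^{iθ}|z||` is controlled by the defect `|z| - Re(e^{-iθ}z)`. -/
theorem modulus_sub_exp_smul_modulus_le (z : LatticeComplexification X) (θ : ℝ) {ε k : ℝ}
    (hε : 0 < ε) (hk : 2 * (k * ε) = 1) :
    (z - Complex.exp (θ * Complex.I) • ⟨z.modulus, 0⟩).modulus ≤
      ε • z.modulus + k • (z.modulus - z.rotation θ) := by
  have hk0 : 0 < k := by
    by_contra! h
    nlinarith [mul_nonpos_of_nonpos_of_nonneg h hε.le]
  refine modulus_le fun ω => ?_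
  have hc := Real.cos_sub ω θ
  -- Collecting the terms in `z` leaves `Re((e^{-iω} + k e^{-iθ})z) ≤ (ε + k + cos(ω - θ))|z|`. As
  -- `2kε = 1`, the square of the right coefficient exceeds that of the left by exactly `(ε + cos(ω
  -- - θ))²`.
  have h := z.smul_re_add_smul_im_le (a := Real.cos ω + k * Real.cos θ)
    (b := Real.sin ω + k * Real.sin θ) (r := ε + k + Real.cos (ω - θ)) ?_ ?_
  · have e : (z - Complex.exp (θ * Complex.I) • ⟨z.modulus, 0⟩).rotation ω =
        ((Real.cos ω + k * Real.cos θ) • z.re + (Real.sin ω + k * Real.sin θ) • z.im) -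
          Real.cos (ω - θ) • z.modulus - k • z.rotation θ := by
      simp only [rotation, sub_re, sub_im, smul_re, smul_im, Complex.exp_ofReal_mul_I_re,
        Complex.exp_ofReal_mul_I_im, hc]
      module
    rw [e]
    refine (sub_le_sub_right (sub_le_sub_right h _) _).trans (le_of_eq ?_)
    module
  · have := Real.neg_one_le_cos (ω - θ)
    nlinarith [sq_nonneg (ε - k)]
  · have h1 := Real.sin_sq_add_cos_sq ω
    have h2 := Real.sin_sq_add_cos_sq θ
    have e : (Real.cos ω + k * Real.cos θ) ^ 2 + (Real.sin ω + k * Real.sin θ) ^ 2 =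
        1 + k ^ 2 + 2 * k * Real.cos (ω - θ) := by
      rw [hc]
      linear_combination h1 + k ^ 2 * h2
    rw [e]
    nlinarith [sq_nonneg (ε + Real.cos (ω - θ))]

theorem add_smul_modulus_le {z : LatticeComplexification X} {x y : X} {k : ℝ} (hk : 0 < k)
    (h : ∀ θ, x + k • z.rotation θ ≤ y) : x + k • z.modulus ≤ y := by
  rw [← le_sub_iff_add_le', ← le_inv_smul_iff_of_pos hk]
  refine modulus_le fun θ => ?_
  rw [le_inv_smul_iff_of_pos hk, le_sub_iff_add_le']
  exact h θ

theorem modulus_exp_smul (β : ℝ) (z : LatticeComplexification X) :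
    (Complex.exp (β * Complex.I) • z).modulus = z.modulus := by
  rw [modulus_smul, Complex.norm_exp_ofReal_mul_I, one_smul]

theorem modulus_sub_le (z w : LatticeComplexification X) :
    (z - w).modulus ≤ z.modulus + w.modulus := by
  have h := modulus_smul (-1) w
  rw [norm_neg, norm_one, one_smul, neg_smul, one_smul] at h
  rw [sub_eq_add_neg, ← h]
  exact modulus_add_le z (-w)

/-- The unit scalars are chosen so that `e^{iα}f - e^{-iα}g` is close to a unit multiple of
`|f| - |g|` wherever `f ≈ e^{iθ}|f|` and `g ≈ e^{iφ}|g|`. -/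
theorem modulus_exp_smul_sub_exp_smul_le (f g : LatticeComplexification X) (θ φ : ℝ) :
    (Complex.exp (((φ - θ) / 2 : ℝ) * Complex.I) • f -
      Complex.exp ((-((φ - θ) / 2) : ℝ) * Complex.I) • g).modulus ≤
      (f - Complex.exp (θ * Complex.I) • ⟨f.modulus, 0⟩).modulus + (|f.modulus - g.modulus| +
        (g - Complex.exp (φ * Complex.I) • ⟨g.modulus, 0⟩).modulus) := by
  have e1 : Complex.exp (((θ + φ) / 2 : ℝ) * Complex.I) =
      Complex.exp (((φ - θ) / 2 : ℝ) * Complex.I) * Complex.exp (θ * Complex.I) := by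
    rw [← Complex.exp_add]
    congr 1
    push_cast
    ring
  have e2 : Complex.exp (((θ + φ) / 2 : ℝ) * Complex.I) =
      Complex.exp ((-((φ - θ) / 2) : ℝ) * Complex.I) * Complex.exp (φ * Complex.I) := by
    rw [← Complex.exp_add]
    congr 1
    push_cast
    ring
  have e3 : (⟨f.modulus - g.modulus, 0⟩ : LatticeComplexification X) =
      ⟨f.modulus, 0⟩ - ⟨g.modulus, 0⟩ := by
    ext <;> simp
  have e : Complex.exp (((φ - θ) / 2 : ℝ) * Complex.I) • f -
        Complex.exp ((-((φ - θ) / 2) : ℝ) * Complex.I) • g =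
      Complex.exp (((φ - θ) / 2 : ℝ) * Complex.I) •
        (f - Complex.exp (θ * Complex.I) • ⟨f.modulus, 0⟩) +
      (Complex.exp (((θ + φ) / 2 : ℝ) * Complex.I) • ⟨f.modulus - g.modulus, 0⟩ -
      Complex.exp ((-((φ - θ) / 2) : ℝ) * Complex.I) •
        (g - Complex.exp (φ * Complex.I) • ⟨g.modulus, 0⟩)) := by
    rw [smul_sub, smul_sub, smul_smul, smul_smul, ← e1, ← e2, e3, smul_sub]
    abel
  rw [e]
  refine (modulus_add_le _ _).trans ?_
  rw [modulus_exp_smul]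
  refine add_le_add le_rfl ((modulus_sub_le _ _).trans ?_)
  rw [modulus_exp_smul, modulus_exp_smul]
  exact add_le_add (modulus_mk_zero_le _) le_rfl

/-- `||f| - |g||` is the infimum of `|f - λg|` over the unit circle. -/
theorem le_abs_modulus_sub_modulus {f g : LatticeComplexification X} {h : X}
    (H : ∀ α : ℝ, h ≤ (Complex.exp (α * Complex.I) • f -
      Complex.exp ((-α : ℝ) * Complex.I) • g).modulus) :
    h ≤ |f.modulus - g.modulus| := by
  -- The phases of `f` and `g` cannot be chosen pointwise, so arbitrary `θ`, `φ` are used at the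
  -- cost of the two defects. Taking suprema over `θ` and `φ` makes the defects vanish, leaving an
  -- error `ε(|f| + |g|)`.
  have key (ε : ℝ) (hε : 0 < ε) :
      h ≤ ε • (f.modulus + g.modulus) + |f.modulus - g.modulus| := by
    obtain ⟨k, hk0, hk⟩ : ∃ k : ℝ, 0 < k ∧ 2 * (k * ε) = 1 :=
      ⟨1 / (2 * ε), by positivity, by field_simp⟩
    have main (θ φ : ℝ) : h + k • f.rotation θ + k • g.rotation φ ≤
        (ε + k) • (f.modulus + g.modulus) + |f.modulus - g.modulus| := by
      have h1 := modulus_sub_exp_smul_modulus_le f θ hε hk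
      have h2 := modulus_sub_exp_smul_modulus_le g φ hε hk
      have h3 := (H ((φ - θ) / 2)).trans ((modulus_exp_smul_sub_exp_smul_le f g θ φ).trans
        (add_le_add h1 (add_le_add le_rfl h2)))
      rw [← sub_nonneg] at h3 ⊢
      refine h3.trans (le_of_eq ?_)
      module
    have h4 := add_smul_modulus_le (z := g) hk0 fun φ => by
      have := add_smul_modulus_le (z := f) (x := h + k • g.rotation φ) hk0 fun θ => by
        rw [add_right_comm]
        exact main θ φ
      rwa [add_right_comm] at this
    rw [← sub_nonneg] at h4 ⊢
    refine h4.trans (le_of_eq ?_)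
    module
  have hlim : Filter.Tendsto
      (fun ε : ℝ => ε • (f.modulus + g.modulus) + |f.modulus - g.modulus|)
      (nhdsWithin 0 (Set.Ioi 0)) (nhds |f.modulus - g.modulus|) := by
    have : Continuous fun ε : ℝ => ε • (f.modulus + g.modulus) + |f.modulus - g.modulus| := by
      fun_prop
    exact (this.tendsto' 0 _ (by simp)).mono_left nhdsWithin_le_nhds
  exact ge_of_tendsto hlim (eventually_nhdsWithin_of_forall fun ε hε => key ε hε)

/-- Here `f' - g' = f - g` and `f' + g' = t(f + g)`, so `e^{iα}f - e^{-iα}g = cos α (f - g) + i sin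
α (f + g)` equals `zf' - z̄g'` with `z = cos α + i (sin α)/t`. Since `t ≤ 1`, `|z| ≥ 1`, and the
modulus is at least `|z| ||f'| - |g'|| ≥ ||f'| - |g'||` for every `α`. -/
theorem norm_modulus_sub_modulus_le (f g : LatticeComplexification X) {t : ℝ} (ht0 : 0 < t)
    (ht1 : t ≤ 1) :
    ‖((1 / 2 : ℂ) • ((t : ℂ) • (f + g) + (f - g))).modulus -
      ((1 / 2 : ℂ) • ((t : ℂ) • (f + g) - (f - g))).modulus‖ ≤ ‖f.modulus - g.modulus‖ := by
  refine norm_le_norm_of_abs_le_abs (le_abs_modulus_sub_modulus fun α => ?_)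
  set f' := (1 / 2 : ℂ) • ((t : ℂ) • (f + g) + (f - g)) with hf'
  set g' := (1 / 2 : ℂ) • ((t : ℂ) • (f + g) - (f - g)) with hg'
  set z : ℂ := Real.cos α + (Real.sin α / t) * Complex.I with hz
  have htc : (t : ℂ) ≠ 0 := by exact_mod_cast ht0.ne'
  have hz1 : 1 ≤ ‖z‖ := by
    refine le_of_sq_le_sq ?_ (norm_nonneg z)
    have e : z = ⟨Real.cos α, Real.sin α / t⟩ := by
      apply Complex.ext <;> simp [hz, ← Complex.ofReal_div, -Complex.ofReal_cos,
        -Complex.ofReal_sin]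
    rw [e, Complex.sq_norm, Complex.normSq_mk, ← sq, ← sq, one_pow, div_pow]
    have h1 : Real.sin α ^ 2 ≤ Real.sin α ^ 2 / t ^ 2 :=
      le_div_self (sq_nonneg _) (by positivity) (pow_le_one₀ ht0.le ht1)
    linarith [Real.sin_sq_add_cos_sq α]
  have e : Complex.exp (α * Complex.I) • f - Complex.exp ((-α : ℝ) * Complex.I) • g =
      z • f' - (starRingEnd ℂ z) • g' := by
    have hz' : starRingEnd ℂ z = Real.cos α - (Real.sin α / t) * Complex.I := by
      rw [hz, map_add, map_mul, map_div₀, Complex.conj_ofReal, Complex.conj_ofReal,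
        Complex.conj_ofReal, Complex.conj_I]
      ring
    have e2 : Real.sin α / t * t = (Real.sin α : ℂ) := div_mul_cancel₀ _ htc
    have e3 : z • f' - (starRingEnd ℂ z) • g' =
        (Real.cos α + (Real.sin α / t * t) * Complex.I : ℂ) • f -
          (Real.cos α - (Real.sin α / t * t) * Complex.I : ℂ) • g := by
      rw [hz', hz, hf', hg']
      module
    rw [e3, e2, Complex.exp_mul_I, Complex.exp_mul_I]
    push_cast
    rw [Complex.cos_neg, Complex.sin_neg, neg_mul, sub_eq_add_neg (Complex.cos _)]
  rw [e]
  refine le_trans ?_ (abs_modulus_sub_modulus_le _ _)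
  rw [modulus_smul z, modulus_smul (starRingEnd ℂ z), Complex.norm_conj, ← smul_sub]
  have h := smul_le_of_abs_le (X := X) (a := ‖z‖⁻¹) (d := 1)
    (by rw [abs_of_nonneg (by positivity)]; exact inv_le_one_of_one_le₀ hz1)
  have hz0 : ‖z‖ ≠ 0 := by positivity
  refine abs_le'.2 ⟨?_, ?_⟩
  · have := h (‖z‖ • (f'.modulus - g'.modulus))
    rwa [one_smul, inv_smul_smul₀ hz0] at this
  · have := h (-(‖z‖ • (f'.modulus - g'.modulus)))
    rwa [one_smul, abs_neg, smul_neg, inv_smul_smul₀ hz0] at this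

end LatticeComplexification

/-! ### Orthogonalization in Hilbert space and the complex case. -/

/-- In a Hilbert space, after multiplying `G` by a unit scalar `c`, rescaling `F + cG` to the length
of `F - cG` turns `F, cG` into an orthogonal pair. -/
theorem exists_unit_smul_rescale_orthogonal {H : Type*} [NormedAddCommGroup H]
    [InnerProductSpace ℂ H] {F G : H} (hFG : ∀ c : ℂ, F - c • G ≠ 0) :
    ∃ c : ℂ, ‖c‖ = 1 ∧ ∃ t : ℝ, 0 < t ∧ t ≤ 1 ∧ ∃ F' G' : H,
      F' = (1 / 2 : ℂ) • ((t : ℂ) • (F + c • G) + (F - c • G)) ∧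
      G' = (1 / 2 : ℂ) • ((t : ℂ) • (F + c • G) - (F - c • G)) ∧
      ‖F'‖ ^ 2 + ‖G'‖ ^ 2 = ‖F - c • G‖ ^ 2 ∧
      ∀ l : ℂ, ‖l‖ = 1 → ‖F' - l • G'‖ ^ 2 = ‖F - c • G‖ ^ 2 := by
  obtain ⟨c, hc1, r, hr0, hcr⟩ :
      ∃ c : ℂ, ‖c‖ = 1 ∧ ∃ r : ℝ, 0 ≤ r ∧ inner ℂ F (c • G) = (r : ℂ) := by
    refine ⟨Complex.exp ((-(inner ℂ F G).arg : ℝ) * Complex.I), Complex.norm_exp_ofReal_mul_I _,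
      ‖inner ℂ F G‖, norm_nonneg _, ?_⟩
    rw [inner_smul_right]
    nth_rewrite 2 [← Complex.norm_mul_exp_arg_mul_I (inner ℂ F G)]
    rw [mul_left_comm, ← Complex.exp_add]
    simp
  set U := F - c • G with hU
  set V := F + c • G with hV
  have hUpos : 0 < ‖U‖ := norm_pos_iff.2 (hFG c)
  have hVpos : 0 < ‖V‖ := norm_pos_iff.2 (by simpa [hV] using hFG (-c))
  -- The squares differ by `4r ≥ 0`; this is what gives `t ≤ 1`.
  have hUV : ‖U‖ ≤ ‖V‖ := by
    refine le_of_sq_le_sq ?_ hVpos.le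
    rw [hU, hV, norm_sub_sq (𝕜 := ℂ), norm_add_sq (𝕜 := ℂ), hcr]
    simp only [RCLike.re_to_complex, Complex.ofReal_re]
    linarith
  set t := ‖U‖ / ‖V‖ with ht
  have ht0 : 0 < t := div_pos hUpos hVpos
  have htV : ‖(t : ℂ) • V‖ = ‖U‖ := by
    rw [norm_smul, Complex.norm_real, Real.norm_of_nonneg ht0.le, ht, div_mul_cancel₀ _ hVpos.ne']
  have hcr' : inner ℂ (c • G) F = (r : ℂ) := by
    rw [← inner_conj_symm, hcr, Complex.conj_ofReal]
  have hsymm : inner ℂ U V = inner ℂ V U := by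
    rw [hU, hV]
    simp only [inner_sub_left, inner_add_left, inner_sub_right, inner_add_right, hcr, hcr']
    ring
  clear_value U V
  set F' := (1 / 2 : ℂ) • ((t : ℂ) • V + U) with hF'
  set G' := (1 / 2 : ℂ) • ((t : ℂ) • V - U) with hG'
  -- The vectors `tV` and `U` have equal length and a real inner product, so their sum and
  -- difference are orthogonal.
  have horth : inner ℂ F' G' = 0 := by
    rw [hF', hG', inner_smul_left, inner_smul_right, inner_add_left, inner_sub_right,
      inner_sub_right, inner_self_eq_norm_sq_to_K, inner_self_eq_norm_sq_to_K, htV,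
      inner_smul_left, inner_smul_right, hsymm, Complex.conj_ofReal]
    ring
  have hsum : ‖F'‖ ^ 2 + ‖G'‖ ^ 2 = ‖U‖ ^ 2 := by
    have hp := parallelogram_law_with_norm ℂ ((t : ℂ) • V) U
    rw [htV] at hp
    have h2 : ‖(1 / 2 : ℂ)‖ = 1 / 2 := by norm_num
    rw [hF', hG', norm_smul, norm_smul, h2]
    nlinarith
  rw [hV, hU] at hF' hG'
  rw [hU] at hsum
  refine ⟨c, hc1, t, ht0, (div_le_one hVpos).2 hUV, F', G', hF', hG', hsum, fun l hl => ?_⟩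
  rw [norm_sub_sq (𝕜 := ℂ), inner_smul_right, horth, norm_smul l G', hl, ← hsum]
  simp

theorem exists_nearly_orthogonal_pair_complex {X : Type*} [NormedAddCommGroup X]
    [NormedSpace ℝ X] [CompleteSpace X] [Lattice X] [IsOrderedAddMonoid X] [IsOrderedModule ℝ X]
    [HasSolidNorm X] (f g : LatticeComplexification X) (hfg : LinearIndependent ℂ ![f, g]) :
    ∃ f' ∈ Submodule.span ℂ {f, g}, ∃ g' ∈ Submodule.span ℂ {f, g}, ∃ d d' : ℝ,
      IsLeast (phaseDistances ℂ f g) d ∧ IsLeast (phaseDistances ℂ f' g') d' ∧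
      d ≤ Real.sqrt 2 * d' ∧ Real.sqrt (‖f'‖ ^ 2 + ‖g'‖ ^ 2) ≤ Real.sqrt 2 * d' ∧
      ‖f'.modulus - g'.modulus‖ ≤ ‖f.modulus - g.modulus‖ := by
  obtain ⟨F, G, hle⟩ := exists_euclidean_sqrt_two_equiv f g hfg
  have hFG (c : ℂ) : F - c • G ≠ 0 := fun h => by
    have h1 := (hle 1 (-c)).2
    rw [neg_smul, neg_smul, ← sub_eq_add_neg, ← sub_eq_add_neg, one_smul, one_smul, h,
      norm_zero, mul_zero] at h1
    have := LinearIndependent.pair_iff.1 hfg 1 (-c) (by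
      rw [neg_smul, ← sub_eq_add_neg, one_smul]
      exact norm_le_zero_iff.1 h1)
    simp at this
  obtain ⟨c, hc, t, ht0, ht1, F', G', hF', hG', hsum, hl⟩ :=
    exists_unit_smul_rescale_orthogonal hFG
  have hf : f ∈ Submodule.span ℂ {f, g} := Submodule.subset_span (by simp)
  have hg : c • g ∈ Submodule.span ℂ {f, g} :=
    Submodule.smul_mem _ _ (Submodule.subset_span (by simp))
  set f' := (1 / 2 : ℂ) • ((t : ℂ) • (f + c • g) + (f - c • g)) with hf'
  set g' := (1 / 2 : ℂ) • ((t : ℂ) • (f + c • g) - (f - c • g)) with hg'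
  obtain ⟨d, hd⟩ := exists_isLeast_phaseDistances ℂ f g
  obtain ⟨d', hd'⟩ := exists_isLeast_phaseDistances ℂ f' g'
  have comb (a b : ℂ) : a • f' + b • g' =
      ((a + b) * t / 2 + (a - b) / 2) • f + (((a + b) * t / 2 - (a - b) / 2) * c) • g := by
    rw [hf', hg']
    module
  have Comb (a b : ℂ) : a • F' + b • G' =
      ((a + b) * t / 2 + (a - b) / 2) • F + (((a + b) * t / 2 - (a - b) / 2) * c) • G := by
    rw [hF', hG']
    module
  -- The primed pairs are the same combinations of `f, g` and of `F, G`, so the norm comparison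
  -- carries over.
  have hle' (a b : ℂ) : ‖a • F' + b • G'‖ ≤ ‖a • f' + b • g'‖ ∧
      ‖a • f' + b • g'‖ ≤ Real.sqrt 2 * ‖a • F' + b • G'‖ := by
    rw [comb, Comb]
    exact hle _ _
  -- All `‖F' - λG'‖` with `|λ| = 1` equal `‖F - cG‖`, so whichever `λ` attains `d'` gives the
  -- bound.
  have hUd : ‖F - c • G‖ ≤ d' := by
    obtain ⟨l, hl1, rfl⟩ := hd'.1
    have h := (hle' 1 (-l)).1
    rw [neg_smul, neg_smul, ← sub_eq_add_neg, ← sub_eq_add_neg, one_smul, one_smul] at h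
    rwa [(pow_left_inj₀ (norm_nonneg _) (norm_nonneg _) two_ne_zero).1 (hl l hl1)] at h
  refine ⟨f', ?_, g', ?_, d, d', hd, hd', ?_, ?_, ?_⟩
  · exact Submodule.smul_mem _ _
      (add_mem (Submodule.smul_mem _ _ (add_mem hf hg)) (sub_mem hf hg))
  · exact Submodule.smul_mem _ _
      (sub_mem (Submodule.smul_mem _ _ (add_mem hf hg)) (sub_mem hf hg))
  · have h := (hle 1 (-c)).2
    rw [neg_smul, neg_smul, ← sub_eq_add_neg, ← sub_eq_add_neg, one_smul, one_smul] at h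
    exact (hd.2 ⟨c, hc, rfl⟩).trans (h.trans (by gcongr))
  · have h1 := (hle' 1 0).2
    have h2 := (hle' 0 1).2
    simp only [one_smul, zero_smul, add_zero, zero_add] at h1 h2
    refine Real.sqrt_le_iff.2 ⟨by have := (norm_nonneg _).trans hUd; positivity, ?_⟩
    calc ‖f'‖ ^ 2 + ‖g'‖ ^ 2 ≤ (Real.sqrt 2 * ‖F'‖) ^ 2 + (Real.sqrt 2 * ‖G'‖) ^ 2 := by gcongr
      _ = (Real.sqrt 2 * ‖F - c • G‖) ^ 2 := by rw [mul_pow, mul_pow, mul_pow, ← hsum]; ring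
      _ ≤ (Real.sqrt 2 * d') ^ 2 := by gcongr
  · have h := LatticeComplexification.norm_modulus_sub_modulus_le f (c • g) ht0 ht1
    rwa [LatticeComplexification.modulus_smul c g, hc, one_smul] at h

/-- The first part concerns a real Banach lattice `X`, the second one the complex Banach lattice
obtained by complexifying `X`. `IsLeast (phaseDistances 𝕜 f g) d` says that
`d = min_{|λ| = 1} ‖f - λg‖`, the minimum being attained. -/
theorem theorem3p9 (X : Type*) [NormedAddCommGroup X] [NormedSpace ℝ X] [CompleteSpace X]
    [Lattice X] [IsOrderedAddMonoid X] [IsOrderedModule ℝ X] [HasSolidNorm X] :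
    (∃ K : ℝ, K ∈ Set.Icc 1 (Real.sqrt 2) ∧
      ∀ f g : X, LinearIndependent ℝ ![f, g] →
        ∃ f' ∈ Submodule.span ℝ {f, g}, ∃ g' ∈ Submodule.span ℝ {f, g}, ∃ d d' : ℝ,
          IsLeast (phaseDistances ℝ f g) d ∧
          IsLeast (phaseDistances ℝ f' g') d' ∧
          d ≤ K * d' ∧
          Real.sqrt (‖f'‖ ^ 2 + ‖g'‖ ^ 2) ≤ K * d' ∧
          ‖|f'| - |g'|‖ ≤ ‖|f| - |g|‖) ∧
    (∃ K : ℝ, K ∈ Set.Icc 1 (Real.sqrt 2) ∧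
      ∀ f g : LatticeComplexification X, LinearIndependent ℂ ![f, g] →
        ∃ f' ∈ Submodule.span ℂ {f, g}, ∃ g' ∈ Submodule.span ℂ {f, g}, ∃ d d' : ℝ,
          IsLeast (phaseDistances ℂ f g) d ∧
          IsLeast (phaseDistances ℂ f' g') d' ∧
          d ≤ K * d' ∧
          Real.sqrt (‖f'‖ ^ 2 + ‖g'‖ ^ 2) ≤ K * d' ∧
          ‖f'.modulus - g'.modulus‖ ≤ ‖f.modulus - g.modulus‖) := by
  have hK : Real.sqrt 2 ∈ Set.Icc 1 (Real.sqrt 2) := ⟨Real.one_le_sqrt.2 (by norm_num), le_rfl⟩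
  exact ⟨⟨_, hK, exists_nearly_orthogonal_pair_real⟩,
    ⟨_, hK, exists_nearly_orthogonal_pair_complex⟩⟩
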